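/- Let $q\ge 3$ be an integer. For integers $n\ge 2$ and $m\ge 0$, let a random graph on $n$ labelled vertices be formed by selecting $m$ edges uniformly at random from the $\binom n2$ possible edges, either without replacement (so that $m\le\binom n2$) or with replacement (repeated edges being irrelevant to colorability). Then for either way of selecting the edges the transition from $q$-colorable to not $q$-colorable has characteristic width at least of order $\sqrt n$, in the following sense. There is a constant $c>0$, depending only on $q$, such that for all fixed real numbers $1>p_1>p_2>0$ there is an $N$ such that for all $n\ge N$ and all admissible $m_1,m_2$: if the random graph with $n$ vertices and $m_1$ edges is $q$-colorable with probability $\ge p_1$, and the random graph with $n$ vertices and $m_2$ edges is $q$-colorable with probability $\le p_2$, then $$m_2-m_1\;\ge\; c\,(p_1-p_2)\,\sqrt n .$$ -/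

import Mathlib

namespace RandomColoring

/-- The possible edges of a graph on `n` labelled vertices: the unordered pairs of distinct
vertices. There are `n.choose 2` of them. -/
abbrev Edge (n : ℕ) : Type := {e : Sym2 (Fin n) // ¬ e.IsDiag}

/-- The graph on `n` vertices spanned by a set of edges. -/
def graphOf {n : ℕ} (A : Set (Edge n)) : SimpleGraph (Fin n) :=
  SimpleGraph.fromEdgeSet (Subtype.val '' A)

/-- The probability that a graph on `n` vertices is `q`-colorable when its `m` edges are selected
uniformly at random without replacement (`m ≤ n.choose 2`), that is, when its edge set is a
uniformly random `m`-element set of edges. -/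
noncomputable def probWithoutReplacement (q n m : ℕ) : ℝ :=
  (Nat.card {s : Finset (Edge n) // s.card = m ∧ (graphOf (s : Set (Edge n))).Colorable q} : ℝ) /
    (Nat.card {s : Finset (Edge n) // s.card = m} : ℝ)

/-- The probability that a graph on `n` vertices is `q`-colorable when its `m` edges are selected
uniformly at random with replacement, that is, as a uniformly random sequence of `m` edges. -/
noncomputable def probWithReplacement (q n m : ℕ) : ℝ :=
  (Nat.card {f : Fin m → Edge n // (graphOf (Set.range f)).Colorable q} : ℝ) /
    (Nat.card (Fin m → Edge n) : ℝ)

/-- Let `P m` be the probability of a property for `m` random items, where `m` ranges over the set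
`D` of admissible numbers of items. The number of items must be increased by at least `w` for the
probability to drop from at least `p₁` to at most `p₂`. -/
def TransitionWidthAtLeast (D : Set ℕ) (P : ℕ → ℝ) (p₁ p₂ w : ℝ) : Prop :=
  ∀ m₁ ∈ D, ∀ m₂ ∈ D, p₁ ≤ P m₁ → P m₂ ≤ p₂ → w ≤ (m₂ : ℝ) - (m₁ : ℝ)

end RandomColoring

namespace RandomColoring

open Finset

/-! It suffices that one more edge lowers the probability of colorability by at most `C / √n`;
summing these drops over the steps from `m₁` to `m₂` gives the width, with `c = 1 / C`. Both models
are treated together as uniform sequences of edges, with repetition allowed exactly when `R` holds.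

Let `X` be the number of isolated vertices. Given all edges but the `j`-th, that edge meets on
average `κX'` of the `X'` isolated vertices left by the others, so `dev κ f j` has conditional mean
zero. An edge that destroys colorability meets none of them, which forces its deviation to be `κX`:
critical edges are biased (`sum_crit_mul_isolated`). Summing over `j` and applying Cauchy–Schwarz,
the expectation of `κX` times the number of critical edges is at most the standard deviation of the
sum of all deviations. That sum changes little with any one edge, so its variance is small
(`sum_sq_sum_dev_le`). All positions have the same probability of being critical, namely the drop
from `s` to `s + 1` edges (`sum_crit`).

For `s = O(n)`, `X` has mean of order `n` (`le_meanIsolated`) and variance at most `n`, `κ` has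
order `1 / n`, and the drop is `O(1 / √n)`. For larger `s`, a first moment bound over all colorings
makes the probability itself at most `exp (-n)` (`prob_le_exp_neg`). -/

open scoped Classical in
/-- The sequences of `s` items, with repetitions if `R` holds and without repetitions otherwise. -/
noncomputable def seqs (E : Type*) [Fintype E] (R : Prop) (s : ℕ) : Finset (Fin s → E) :=
  univ.filter fun f => R ∨ Function.Injective f

open scoped Classical in
/-- The items that may be added to a sequence of distinct items, or to any sequence if `R` holds. -/
noncomputable def nexts {E : Type*} [Fintype E] (R : Prop) {s : ℕ} (g : Fin s → E) : Finset E :=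
  univ.filter fun b => R ∨ b ∉ Set.range g

open scoped Classical in
/-- The number of ways to select another item out of `a` items when `i` have been selected. -/
noncomputable def step (R : Prop) (a i : ℕ) : ℕ := if R then a else a - i

/-! ### Counting sequences drawn with or without repetition. -/

section Sequences

variable {E : Type*} [Fintype E] {R : Prop} {s : ℕ}

lemma mem_seqs {f : Fin s → E} : f ∈ seqs E R s ↔ R ∨ Function.Injective f := by
  simp [seqs]

lemma mem_nexts {g : Fin s → E} {b : E} : b ∈ nexts R g ↔ R ∨ b ∉ Set.range g := by
  simp [nexts]

lemma insertNth_mem_seqs {j : Fin (s + 1)} {g : Fin s → E} {b : E} :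
    j.insertNth (α := fun _ => E) b g ∈ seqs E R (s + 1) ↔ g ∈ seqs E R s ∧ b ∈ nexts R g := by
  rw [mem_seqs, mem_seqs, mem_nexts]
  by_cases hR : R
  · simp [hR]
  · simp only [hR, false_or]
    constructor
    · intro h
      refine ⟨fun a a' haa => ?_, ?_⟩
      · simpa using @h (j.succAbove a) (j.succAbove a') (by simpa using haa)
      · rintro ⟨a, rfl⟩
        exact j.succAbove_ne a (h (by simp))
    · rintro ⟨hg, hb⟩ x y
      revert x y
      simp only [j.forall_iff_succAbove, Fin.insertNth_apply_same, Fin.insertNth_apply_succAbove]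
      refine ⟨⟨fun _ => trivial, fun i hi => (hb ⟨i, hi.symm⟩).elim⟩,
        fun i => ⟨fun hi => (hb ⟨i, hi⟩).elim, fun i' hi => by rw [hg hi]⟩⟩

/-- A sequence of `s + 1` items is a sequence of `s` items together with one more item. -/
lemma sum_seqs_succ {M : Type*} [AddCommMonoid M] (j : Fin (s + 1)) (φ : (Fin (s + 1) → E) → M) :
    ∑ f ∈ seqs E R (s + 1), φ f =
      ∑ g ∈ seqs E R s, ∑ b ∈ nexts R g, φ (j.insertNth (α := fun _ => E) b g) := by
  rw [Finset.sum_sigma']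
  refine Finset.sum_bij' (fun f _ => (⟨j.removeNth f, f j⟩ : (_ : Fin s → E) × E))
    (fun p _ => j.insertNth (α := fun _ => E) p.2 p.1) ?_ ?_ ?_ ?_ ?_
  · intro f hf
    have : j.insertNth (α := fun _ => E) (f j) (j.removeNth f) ∈ seqs E R (s + 1) := by
      rwa [Fin.insertNth_self_removeNth]
    rw [insertNth_mem_seqs] at this
    simpa using this
  · intro p hp
    rw [insertNth_mem_seqs]
    simpa using hp
  · intro f _
    simp
  · rintro ⟨g, b⟩ _
    simp
  · intro f _
    simp

variable [DecidableEq E]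

lemma card_filter_nexts {g : Fin s → E} (hg : g ∈ seqs E R s) (A : Finset E)
    (hA : ∀ i, g i ∈ A) : #{b ∈ nexts R g | b ∈ A} = step R #A s := by
  unfold step
  split_ifs with hR
  · congr 1
    ext b
    simp [mem_nexts, hR]
  · have hinj : Function.Injective g := (mem_seqs.1 hg).resolve_left hR
    have h1 : ({b ∈ nexts R g | b ∈ A} : Finset E) = A \ univ.image g := by
      ext b
      simp [mem_nexts, hR, and_comm]
    rw [h1, card_sdiff_of_subset, card_image_of_injective _ hinj]
    · simp
    · intro b hb
      obtain ⟨i, -, rfl⟩ := mem_image.1 hb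
      exact hA i

lemma card_nexts {g : Fin s → E} (hg : g ∈ seqs E R s) :
    #(nexts R g) = step R (Fintype.card E) s := by
  have := card_filter_nexts hg univ (by simp)
  simpa using this

/-- The number of sequences with items in a given set. -/
lemma card_seqs_filter (A : Finset E) (s : ℕ) :
    #{f ∈ seqs E R s | ∀ i, f i ∈ A} = ∏ i ∈ range s, step R #A i := by
  induction s with
  | zero =>
    have : ({f ∈ seqs E R 0 | ∀ i, f i ∈ A} : Finset _) = univ := by
      ext f
      simp [mem_seqs, Function.injective_of_subsingleton, Subsingleton.elim f default]
    rw [this]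
    simp
  | succ s ih =>
    rw [prod_range_succ, ← ih, card_filter, sum_seqs_succ 0, card_filter, sum_mul]
    refine sum_congr rfl fun g hg => ?_
    by_cases hA : ∀ i, g i ∈ A
    · rw [if_pos hA, one_mul, ← card_filter_nexts hg A hA, card_filter]
      refine sum_congr rfl fun b _ => ?_
      simp [Fin.forall_fin_succ, hA]
    · rw [if_neg hA, zero_mul]
      refine sum_eq_zero fun b _ => ?_
      simp [Fin.forall_fin_succ, hA]

lemma card_seqs (s : ℕ) :
    #(seqs E R s) = ∏ i ∈ range s, step R (Fintype.card E) i := by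
  have := card_seqs_filter (R := R) (univ : Finset E) s
  simpa using this

end Sequences

/-! ### Counting edges at, or away from, given vertices. -/

section Edges

variable {n : ℕ}

lemma card_edge (n : ℕ) : Fintype.card (Edge n) = n.choose 2 := by
  have := Sym2.card_subtype_not_diag (α := Fin n)
  simpa using this

lemma card_ends (b : Edge n) : #{v | v ∈ b.1} = 2 := by
  obtain ⟨b, hb⟩ := b
  induction b with
  | h x y =>
    have hxy : x ≠ y := by simpa using hb
    rw [← card_pair hxy]
    congr 1
    ext v
    simp

lemma card_edges_at (v : Fin n) : #{b : Edge n | v ∈ b.1} = n - 1 := by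
  have h : #(univ.erase v : Finset (Fin n)) = n - 1 := by
    rw [card_erase_of_mem (mem_univ v), card_univ, Fintype.card_fin]
  rw [← h]
  symm
  refine card_bij (fun w hw => ⟨s(v, w), ?_⟩) ?_ ?_ ?_
  · simpa using (ne_of_mem_erase hw).symm
  · intro w _
    simp
  · intro w _ w' _ hww
    have : w = w' ∨ v = w' ∧ w = v := by simpa using hww
    grind
  · rintro ⟨b, hb⟩ hv
    obtain ⟨w, rfl⟩ : v ∈ b := by simpa using hv
    exact ⟨w, by simpa [eq_comm] using hb, rfl⟩

lemma card_edges_avoiding (v : Fin n) : #{b : Edge n | v ∉ b.1} = n.choose 2 - (n - 1) := by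
  have h := card_filter_add_card_filter_not (s := (univ : Finset (Edge n))) (fun b => v ∈ b.1)
  rw [card_edges_at, card_univ, card_edge] at h
  omega

lemma card_edges_avoiding_two {v w : Fin n} (hvw : v ≠ w) :
    #{b : Edge n | v ∉ b.1 ∧ w ∉ b.1} ≤ n.choose 2 - (2 * n - 3) := by
  have h1 := card_union_add_card_inter ({b : Edge n | v ∈ b.1} : Finset _)
    ({b : Edge n | w ∈ b.1} : Finset _)
  have h2 : #(({b : Edge n | v ∈ b.1} : Finset _) ∩ ({b : Edge n | w ∈ b.1} : Finset _)) ≤ 1 := by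
    refine card_le_one.2 fun a ha b hb => Subtype.ext ?_
    simp only [mem_inter, mem_filter, mem_univ, true_and] at ha hb
    rw [(Sym2.mem_and_mem_iff hvw).1 ha, (Sym2.mem_and_mem_iff hvw).1 hb]
  have h3 : ({b : Edge n | v ∉ b.1 ∧ w ∉ b.1} : Finset _) =
      (({b : Edge n | v ∈ b.1} : Finset _) ∪ ({b : Edge n | w ∈ b.1} : Finset _))ᶜ := by
    ext b
    simp
  rw [h3, card_compl, card_edge]
  rw [card_edges_at, card_edges_at] at h1
  omega

end Edges

/-! ### Isolated vertices and leaves under a change of one edge. -/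

section Degrees

variable {n s : ℕ}

/-- The number of edges of a sequence that contain a given vertex. -/
def deg (g : Fin s → Edge n) (v : Fin n) : ℕ := ∑ i, if v ∈ (g i).1 then 1 else 0

/-- The number of isolated vertices. -/
def isolated (g : Fin s → Edge n) : ℕ := #{v | deg g v = 0}

/-- The number of vertices of degree one. -/
def leaves (g : Fin s → Edge n) : ℕ := #{v | deg g v = 1}

lemma deg_eq_zero {g : Fin s → Edge n} {v : Fin n} : deg g v = 0 ↔ ∀ i, v ∉ (g i).1 := by
  simp [deg]

lemma deg_insertNth (g : Fin s → Edge n) (j : Fin (s + 1)) (b : Edge n) (v : Fin n) :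
    deg (j.insertNth (α := fun _ => Edge n) b g) v = (if v ∈ b.1 then 1 else 0) + deg g v := by
  simp [deg, Fin.sum_univ_succAbove _ j]

lemma deg_removeNth (f : Fin (s + 1) → Edge n) (j : Fin (s + 1)) (v : Fin n) :
    deg f v = (if v ∈ (f j).1 then 1 else 0) + deg (j.removeNth f) v := by
  rw [← deg_insertNth _ j, Fin.insertNth_self_removeNth]

lemma isolated_insertNth (g : Fin s → Edge n) (j : Fin (s + 1)) (b : Edge n) :
    isolated (j.insertNth (α := fun _ => Edge n) b g) + #{v | deg g v = 0 ∧ v ∈ b.1} =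
      isolated g := by
  have h := card_filter_add_card_filter_not (s := ({v | deg g v = 0} : Finset (Fin n)))
    (fun v => v ∈ b.1)
  rw [filter_filter, filter_filter] at h
  rw [isolated, isolated, ← h, add_comm]
  congr 2
  ext v
  simp only [deg_insertNth, mem_filter, mem_univ, true_and]
  split_ifs with hv <;> simp [hv]

lemma card_isolated_ends_le (g : Fin s → Edge n) (b : Edge n) :
    #{v | deg g v = 0 ∧ v ∈ b.1} ≤ 2 := by
  rw [← card_ends b]
  exact card_le_card fun v hv => by simp_all

lemma leaves_insertNth_le (g : Fin s → Edge n) (j : Fin (s + 1)) (b : Edge n) :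
    leaves (j.insertNth (α := fun _ => Edge n) b g) ≤ leaves g + 2 := by
  rw [← card_ends b]
  refine (card_le_card fun v hv => ?_).trans (card_union_le _ _)
  simp only [deg_insertNth, mem_filter, mem_univ, true_and, mem_union] at hv ⊢
  split_ifs at hv <;> simp_all

lemma leaves_le_insertNth (g : Fin s → Edge n) (j : Fin (s + 1)) (b : Edge n) :
    leaves g ≤ leaves (j.insertNth (α := fun _ => Edge n) b g) + 2 := by
  rw [← card_ends b]
  refine (card_le_card fun v hv => ?_).trans (card_union_le _ _)
  simp only [deg_insertNth, mem_filter, mem_univ, true_and, mem_union] at hv ⊢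
  split_ifs <;> simp_all

/-- Deleting an edge newly isolates exactly its ends of degree one, and each vertex of degree one
lies on exactly one edge of the sequence. -/
lemma sum_isolated_removeNth (f : Fin (s + 1) → Edge n) :
    ∑ j : Fin (s + 1), isolated (j.removeNth f) = (s + 1) * isolated f + leaves f := by
  have h1 : ∀ j : Fin (s + 1), isolated (j.removeNth f) =
      isolated f + ∑ v, if deg f v = 1 then (if v ∈ (f j).1 then 1 else 0) else 0 := by
    intro j
    have h := isolated_insertNth (j.removeNth f) j (f j)
    rw [Fin.insertNth_self_removeNth] at h
    rw [← h, card_filter]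
    congr 1
    refine sum_congr rfl fun v _ => ?_
    rw [deg_removeNth f j v]
    split_ifs <;> simp_all
  simp_rw [h1]
  rw [sum_add_distrib, sum_comm]
  congr 1
  · simp
  · rw [leaves, card_filter]
    refine sum_congr rfl fun v _ => ?_
    split_ifs with h
    · exact h
    · simp

lemma le_isolated_add (g : Fin s → Edge n) : n ≤ isolated g + 2 * s := by
  have h := card_filter_add_card_filter_not (s := (univ : Finset (Fin n))) (fun v => deg g v = 0)
  have h1 : #{v | ¬ deg g v = 0} ≤ ∑ v, deg g v := by
    rw [card_filter]
    refine sum_le_sum fun v _ => ?_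
    split_ifs <;> omega
  have h2 : ∑ v, deg g v = 2 * s := by
    simp only [deg]
    rw [sum_comm]
    have : ∀ i : Fin s, (∑ v, if v ∈ (g i).1 then 1 else 0) = 2 := fun i => by
      rw [← card_filter, card_ends]
    simp [this, mul_comm]
  rw [card_univ, Fintype.card_fin] at h
  unfold isolated
  omega

variable {R : Prop}

/-- On average a new edge contains the same number of isolated vertices as it would if the
isolated vertices were chosen beforehand. -/
lemma sum_isolated_ends (g : Fin s → Edge n) :
    ∑ b ∈ nexts R g, #{v | deg g v = 0 ∧ v ∈ b.1} = (n - 1) * isolated g := by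
  simp_rw [card_filter]
  rw [sum_comm, isolated, card_filter, mul_sum]
  refine sum_congr rfl fun v _ => ?_
  -- None of the `n - 1` edges at an isolated vertex has been used, so all remain available even
  -- without repetition; the count is exact in both models.
  by_cases hv : deg g v = 0
  · simp only [hv, true_and, if_true, mul_one]
    rw [← card_filter, ← card_edges_at v]
    congr 1
    ext b
    simp only [mem_filter, mem_univ, true_and, and_iff_right_iff_imp]
    intro hb
    rw [mem_nexts]
    right
    rintro ⟨i, rfl⟩
    exact deg_eq_zero.1 hv i hb
  · simp [hv]

end Degrees

/-! ### Colorability and edges at isolated vertices. -/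

section Colorings

variable {n s q : ℕ}

/-- The edges of a sequence can be properly colored with `q` colors. -/
def Col (q : ℕ) (g : Fin s → Edge n) : Prop :=
  ∃ c : Fin n → Fin q, ∀ i, ¬ ((g i).1.map c).IsDiag

lemma colorable_graphOf_iff {A : Set (Edge n)} :
    (graphOf A).Colorable q ↔ ∃ c : Fin n → Fin q, ∀ e ∈ A, ¬ (e.1.map c).IsDiag := by
  constructor
  · rintro ⟨c⟩
    refine ⟨c, ?_⟩
    rintro ⟨e, he⟩ heA
    induction e with
    | h x y =>
      have hxy : x ≠ y := by simpa using he
      have : (graphOf A).Adj x y := by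
        rw [graphOf, SimpleGraph.fromEdgeSet_adj]
        exact ⟨⟨_, heA, rfl⟩, hxy⟩
      simpa using c.valid this
  · rintro ⟨c, hc⟩
    refine ⟨SimpleGraph.Coloring.mk c ?_⟩
    intro x y hxy
    rw [graphOf, SimpleGraph.fromEdgeSet_adj] at hxy
    obtain ⟨⟨e, he, hexy⟩, -⟩ := hxy
    have := hc e he
    rw [hexy] at this
    simpa using this

lemma colorable_range_iff {g : Fin s → Edge n} : (graphOf (Set.range g)).Colorable q ↔ Col q g := by
  rw [colorable_graphOf_iff]
  simp [Col]

lemma Col.removeNth {f : Fin (s + 1) → Edge n} (h : Col q f) (j : Fin (s + 1)) :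
    Col q (j.removeNth f) := by
  obtain ⟨c, hc⟩ := h
  exact ⟨c, fun i => hc _⟩

/-- An edge at an isolated vertex is irrelevant to colorability. -/
lemma Col.insertNth {g : Fin s → Edge n} (h : Col q g) (hq : 2 ≤ q) (j : Fin (s + 1)) {b : Edge n}
    {v : Fin n} (hv : deg g v = 0) (hb : v ∈ b.1) :
    Col q (j.insertNth (α := fun _ => Edge n) b g) := by
  obtain ⟨c, hc⟩ := h
  obtain ⟨w, hw⟩ := hb
  have : Nontrivial (Fin q) := Fin.nontrivial_iff_two_le.2 hq
  obtain ⟨k, hk⟩ := exists_ne (c w)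
  have hvw : w ≠ v := by
    rintro rfl
    exact b.2 (by simp [hw])
  -- Recolor the isolated vertex `v` to differ from the other end of the new edge; no old edge sees
  -- the change.
  refine ⟨Function.update c v k, ?_⟩
  rw [j.forall_iff_succAbove]
  constructor
  · simp [hw, hvw, hk]
  · intro i
    have h1 : (g i).1.map (Function.update c v k) = (g i).1.map c := by
      refine Sym2.map_congr fun x hx => ?_
      rw [Function.update_of_ne]
      rintro rfl
      exact deg_eq_zero.1 hv i hx
    simpa [h1] using hc i

/-- If adding an edge destroys colorability, then its ends were not isolated. -/
lemma isolated_insertNth_of_not_col {g : Fin s → Edge n} (h : Col q g) (hq : 2 ≤ q)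
    (j : Fin (s + 1)) {b : Edge n} (hb : ¬ Col q (j.insertNth (α := fun _ => Edge n) b g)) :
    isolated (j.insertNth (α := fun _ => Edge n) b g) = isolated g := by
  rw [← isolated_insertNth g j b, left_eq_add, card_eq_zero, filter_eq_empty_iff]
  rintro v - ⟨hv, hvb⟩
  exact hb (h.insertNth hq j hv hvb)

end Colorings

lemma step_le (R : Prop) (a i : ℕ) : step R a i ≤ a := by
  unfold step
  split_ifs <;> omega

/-! ### Deviations, their variance, and their bias at critical edges. -/

section Fluctuations

variable {n s q : ℕ} {R : Prop} {κ : ℝ}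

/-- The deviation of the number of isolated vertices from its conditional mean given all edges but
the `j`-th. -/
noncomputable def dev (κ : ℝ) (f : Fin (s + 1) → Edge n) (j : Fin (s + 1)) : ℝ :=
  isolated f - (1 - κ) * isolated (j.removeNth f)

lemma dev_insertNth (κ : ℝ) (g : Fin s → Edge n) (j : Fin (s + 1)) (b : Edge n) :
    dev κ (j.insertNth (α := fun _ => Edge n) b g) j =
      κ * isolated g - (#{v | deg g v = 0 ∧ v ∈ b.1} : ℕ) := by
  have h : (isolated (j.insertNth (α := fun _ => Edge n) b g) : ℝ) +
      (#{v | deg g v = 0 ∧ v ∈ b.1} : ℕ) = isolated g := by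
    exact_mod_cast isolated_insertNth g j b
  rw [dev, Fin.removeNth_insertNth, ← h]
  ring

variable (hκ : κ * step R (n.choose 2) s = (n - 1 : ℕ))
include hκ

lemma sum_isolated_ends_eq {g : Fin s → Edge n} :
    ∑ b ∈ nexts R g, ((#{v | deg g v = 0 ∧ v ∈ b.1} : ℕ) : ℝ) =
      step R (n.choose 2) s * (κ * isolated g) := by
  rw [← mul_assoc, mul_comm _ κ, hκ]
  exact_mod_cast sum_isolated_ends g

/-- The deviation has conditional mean zero given the other edges, so it is orthogonal to every
function of them. -/
lemma sum_dev (ψ : (Fin s → Edge n) → ℝ) (j : Fin (s + 1)) :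
    ∑ f ∈ seqs (Edge n) R (s + 1), ψ (j.removeNth f) * dev κ f j = 0 := by
  rw [sum_seqs_succ j]
  refine sum_eq_zero fun g hg => ?_
  simp only [Fin.removeNth_insertNth, dev_insertNth]
  rw [← mul_sum, sum_sub_distrib, sum_isolated_ends_eq hκ, sum_const, card_nexts hg, card_edge,
    nsmul_eq_mul, sub_self, mul_zero]

/-- With `u ≤ 2` isolated ends of mean `κX ≤ 2`, `|κX - u| ≤ (2 - u) + (2 - κX)`, which averages to
`2 * (2 - κX)`. Since `κ ≥ 2 / n` and `X ≥ n - 2s`, this is at most `8s / n`. The factor `s / n`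
matters for small `s`, where almost every edge meets two isolated vertices. -/
lemma sum_abs_dev_le (hn : 2 ≤ n) (hL : 0 < step R (n.choose 2) s) (j : Fin (s + 1)) :
    ∑ f ∈ seqs (Edge n) R (s + 1), |dev κ f j| ≤ #(seqs (Edge n) R (s + 1)) * (8 * s / n) := by
  have hW : (#(seqs (Edge n) R (s + 1)) : ℝ) =
      ∑ _g ∈ seqs (Edge n) R s, (step R (n.choose 2) s : ℝ) := by
    rw [sum_const, nsmul_eq_mul, card_seqs, card_seqs, prod_range_succ, card_edge]
    push_cast
    rfl
  rw [hW, sum_mul, sum_seqs_succ j]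
  refine sum_le_sum fun g hg => ?_
  have hL' : (0 : ℝ) < step R (n.choose 2) s := by exact_mod_cast hL
  have hn' : (0 : ℝ) < n := by positivity
  have hu : ∀ b : Edge n, ((#{v | deg g v = 0 ∧ v ∈ b.1} : ℕ) : ℝ) ≤ 2 := fun b => by
    exact_mod_cast card_isolated_ends_le g b
  have hsum := sum_isolated_ends_eq hκ (g := g)
  have hcard : (#(nexts R g) : ℝ) = step R (n.choose 2) s := by
    rw [card_nexts hg, card_edge]
  have hle : κ * isolated g ≤ 2 := by
    refine le_of_mul_le_mul_left ?_ hL'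
    rw [← hsum, ← hcard, ← nsmul_eq_mul, ← sum_const]
    exact sum_le_sum fun b _ => hu b
  have hge : 2 / n ≤ κ := by
    have h1 : (step R (n.choose 2) s : ℝ) ≤ n * (n - 1) / 2 := by
      rw [← Nat.cast_choose_two ℝ n]
      exact_mod_cast step_le _ _ _
    have h2 : ((n - 1 : ℕ) : ℝ) = n - 1 := by
      rw [Nat.cast_sub (by omega)]; simp
    have h3 : κ = (n - 1) / step R (n.choose 2) s := by
      rw [eq_div_iff hL'.ne', hκ, h2]
    have h4 : (0 : ℝ) < n - 1 := by
      have : (2 : ℝ) ≤ n := by exact_mod_cast hn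
      linarith
    rw [h3, div_le_div_iff₀ hn' hL']
    linarith
  have hX : 2 - κ * isolated g ≤ 4 * s / n := by
    have h1 : (n : ℝ) ≤ isolated g + 2 * s := by exact_mod_cast le_isolated_add g
    have h2 : 2 / (n : ℝ) * isolated g ≤ κ * isolated g := by gcongr
    have h3 : 2 / (n : ℝ) * n ≤ 2 / (n : ℝ) * (isolated g + 2 * s) := by gcongr
    have h4 : 2 / (n : ℝ) * n = 2 := by field_simp
    have h5 : 2 / (n : ℝ) * (2 * s) = 4 * s / n := by ring
    rw [mul_add] at h3
    linarith
  calc ∑ b ∈ nexts R g, |dev κ (j.insertNth (α := fun _ => Edge n) b g) j|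
      ≤ ∑ b ∈ nexts R g,
        ((2 - ((#{v | deg g v = 0 ∧ v ∈ b.1} : ℕ) : ℝ)) + (2 - κ * isolated g)) := by
        refine sum_le_sum fun b _ => ?_
        have := hu b
        rw [dev_insertNth, abs_le]
        constructor <;> linarith
    _ = step R (n.choose 2) s * (2 * (2 - κ * isolated g)) := by
        rw [sum_add_distrib, sum_sub_distrib, hsum, sum_const, sum_const, nsmul_eq_mul,
          nsmul_eq_mul, hcard]
        ring
    _ ≤ step R (n.choose 2) s * (8 * s / n) := by
        refine mul_le_mul_of_nonneg_left ?_ hL'.le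
        have : 8 * (s : ℝ) / n = 2 * (4 * s / n) := by ring
        linarith

-- The total deviation depends only on the numbers of isolated vertices and leaves, each of which
-- one edge changes by at most 2.
omit hκ in
lemma sum_dev_univ (κ : ℝ) (f : Fin (s + 1) → Edge n) :
    ∑ j, dev κ f j = (s + 1) * κ * isolated f - (1 - κ) * leaves f := by
  have h : ∑ j : Fin (s + 1), (isolated (j.removeNth f) : ℝ) =
      (s + 1) * isolated f + leaves f := by
    exact_mod_cast sum_isolated_removeNth f
  simp only [dev]
  rw [sum_sub_distrib, ← mul_sum, h]
  simp
  ring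

/-- The sum of the deviations has small variance, because changing one edge has little effect. -/
lemma sum_sq_sum_dev_le (hn : 2 ≤ n) (hL : 0 < step R (n.choose 2) s) (h0 : 0 ≤ κ) (h1 : κ ≤ 1) :
    ∑ f ∈ seqs (Edge n) R (s + 1), (∑ j, dev κ f j) ^ 2 ≤
      #(seqs (Edge n) R (s + 1)) * ((s + 1) * (2 * (s + 1) * κ + 2) * (8 * s / n)) := by
  have hj : ∀ j : Fin (s + 1), ∑ f ∈ seqs (Edge n) R (s + 1), (∑ i, dev κ f i) * dev κ f j ≤
      (2 * (s + 1) * κ + 2) * (#(seqs (Edge n) R (s + 1)) * (8 * s / n)) := by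
    intro j
    -- Subtract the same expression for the other edges, which is orthogonal to the `j`-th
    -- deviation; only the effect of the `j`-th edge on the total remains.
    have hz := sum_dev hκ
      (fun g => (s + 1) * κ * isolated g - (1 - κ) * leaves g) j
    rw [← sub_zero (∑ f ∈ seqs (Edge n) R (s + 1), (∑ i, dev κ f i) * dev κ f j), ← hz,
      ← sum_sub_distrib]
    refine le_trans ?_ (mul_le_mul_of_nonneg_left (sum_abs_dev_le hκ hn hL j) (by positivity))
    rw [mul_sum]
    refine sum_le_sum fun f _ => ?_
    rw [← sub_mul, sum_dev_univ]
    refine (le_abs_self _).trans ?_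
    rw [abs_mul]
    refine mul_le_mul_of_nonneg_right ?_ (abs_nonneg _)
    have e : j.insertNth (α := fun _ => Edge n) (f j) (j.removeNth f) = f :=
      Fin.insertNth_self_removeNth j f
    have a1 := isolated_insertNth (j.removeNth f) j (f j)
    have a2 := card_isolated_ends_le (j.removeNth f) (f j)
    have a3 := leaves_insertNth_le (j.removeNth f) j (f j)
    have a4 := leaves_le_insertNth (j.removeNth f) j (f j)
    rw [e] at a1 a3 a4
    have b1 : (isolated f : ℝ) ≤ isolated (j.removeNth f) := by exact_mod_cast (by omega)
    have b2 : (isolated (j.removeNth f) : ℝ) ≤ isolated f + 2 := by exact_mod_cast (by omega)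
    have b3 : (leaves f : ℝ) ≤ leaves (j.removeNth f) + 2 := by exact_mod_cast a3
    have b4 : (leaves (j.removeNth f) : ℝ) ≤ leaves f + 2 := by exact_mod_cast a4
    have c1 : |((s : ℝ) + 1) * κ * (isolated f - isolated (j.removeNth f))| ≤
        (s + 1) * κ * 2 := by
      rw [abs_mul, abs_of_nonneg (by positivity : 0 ≤ ((s : ℝ) + 1) * κ)]
      refine mul_le_mul_of_nonneg_left ?_ (by positivity)
      rw [abs_le]
      constructor <;> linarith
    have c2 : |(1 - κ) * ((leaves f : ℝ) - leaves (j.removeNth f))| ≤ 1 * 2 := by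
      rw [abs_mul]
      refine mul_le_mul ?_ ?_ (abs_nonneg _) zero_le_one
      · rw [abs_le]
        constructor <;> linarith
      · rw [abs_le]
        constructor <;> linarith
    calc _ = |((s : ℝ) + 1) * κ * (isolated f - isolated (j.removeNth f)) -
          (1 - κ) * ((leaves f : ℝ) - leaves (j.removeNth f))| := by
          congr 1
          ring
      _ ≤ _ := (abs_sub _ _).trans (add_le_add c1 c2)
      _ = _ := by ring
  calc ∑ f ∈ seqs (Edge n) R (s + 1), (∑ j, dev κ f j) ^ 2
      = ∑ j, ∑ f ∈ seqs (Edge n) R (s + 1), (∑ i, dev κ f i) * dev κ f j := by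
        rw [sum_comm]
        refine sum_congr rfl fun f _ => ?_
        rw [← mul_sum, sq]
    _ ≤ ∑ _j : Fin (s + 1),
        (2 * (s + 1) * κ + 2) * (#(seqs (Edge n) R (s + 1)) * (8 * s / n)) :=
        sum_le_sum fun j _ => hj j
    _ = _ := by
        rw [sum_const, card_univ, Fintype.card_fin, nsmul_eq_mul]
        push_cast
        ring

open scoped Classical in
/-- Indicates that the `j`-th edge destroys colorability. -/
noncomputable def crit (q : ℕ) (f : Fin (s + 1) → Edge n) (j : Fin (s + 1)) : ℝ :=
  if Col q (j.removeNth f) ∧ ¬ Col q f then 1 else 0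

-- By orthogonality, the indicator that `f` is not colorable may be reduced by that for the other
-- edges, leaving `crit q f j`. Where this is nonzero, the `j`-th edge met no isolated vertex and
-- the deviation is `κ * isolated f`.
open scoped Classical in
lemma sum_crit_mul_isolated (hq : 2 ≤ q) (j : Fin (s + 1)) :
    ∑ f ∈ seqs (Edge n) R (s + 1), (if Col q f then 0 else 1) * dev κ f j =
      κ * ∑ f ∈ seqs (Edge n) R (s + 1), crit q f j * isolated f := by
  have hz := sum_dev hκ (fun g => if Col q g then 0 else 1) j
  refine (sub_eq_self.2 hz).symm.trans ?_
  rw [← sum_sub_distrib, mul_sum]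
  refine sum_congr rfl fun f _ => ?_
  by_cases hf : Col q f
  · simp [crit, hf, hf.removeNth j]
  · by_cases hj : Col q (j.removeNth f)
    · have h := isolated_insertNth_of_not_col hj hq j (b := f j)
        (by rwa [Fin.insertNth_self_removeNth])
      rw [Fin.insertNth_self_removeNth] at h
      simp only [crit, hf, hj, dev, ← h]
      simp
      ring
    · simp [crit, hf, hj]

lemma sum_sum_crit_mul_isolated_le (hq : 2 ≤ q) (hn : 2 ≤ n) (hL : 0 < step R (n.choose 2) s)
    (h0 : 0 ≤ κ) (h1 : κ ≤ 1) :
    κ * ∑ f ∈ seqs (Edge n) R (s + 1), (∑ j, crit q f j) * isolated f ≤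
      #(seqs (Edge n) R (s + 1)) *
        √((s + 1) * (2 * (s + 1) * κ + 2) * (8 * s / n)) := by
  classical
  have e : κ * ∑ f ∈ seqs (Edge n) R (s + 1), (∑ j, crit q f j) * isolated f =
      ∑ f ∈ seqs (Edge n) R (s + 1), (if Col q f then 0 else 1) * ∑ j, dev κ f j := by
    simp_rw [sum_mul, mul_sum]
    rw [sum_comm, sum_comm (s := seqs (Edge n) R (s + 1))]
    refine sum_congr rfl fun j _ => ?_
    rw [sum_crit_mul_isolated hκ hq j, mul_sum]
  rw [e]
  refine (Real.sum_mul_le_sqrt_mul_sqrt _ _ _).trans ?_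
  have hW : ∑ f ∈ seqs (Edge n) R (s + 1), (if Col q f then (0 : ℝ) else 1) ^ 2 ≤
      #(seqs (Edge n) R (s + 1)) := by
    rw [← mul_one (#(seqs (Edge n) R (s + 1)) : ℝ), ← nsmul_eq_mul, ← sum_const]
    refine sum_le_sum fun f _ => ?_
    split_ifs <;> simp
  refine (mul_le_mul (Real.sqrt_le_sqrt hW)
    (Real.sqrt_le_sqrt (sum_sq_sum_dev_le hκ hn hL h0 h1)) (Real.sqrt_nonneg _)
    (Real.sqrt_nonneg _)).trans ?_
  rw [Real.sqrt_mul (Nat.cast_nonneg _), ← mul_assoc, Real.mul_self_sqrt (Nat.cast_nonneg _)]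

end Fluctuations

/-! ### Moments of the number of isolated vertices and the drop at one step. -/

open scoped Classical in
/-- The probability that a random sequence of `s` edges can be colored. -/
noncomputable def prob (R : Prop) (q n s : ℕ) : ℝ :=
  #{f ∈ seqs (Edge n) R s | Col q f} / #(seqs (Edge n) R s)

/-- The expected number of vertices that are isolated after `s` random edges. -/
noncomputable def meanIsolated (R : Prop) (n s : ℕ) : ℝ :=
  (∑ f ∈ seqs (Edge n) R s, (isolated f : ℝ)) / #(seqs (Edge n) R s)

section Moments

variable {n s q : ℕ} {R : Prop}

lemma isolated_eq_sum (f : Fin s → Edge n) :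
    isolated f = ∑ v, if (∀ i, f i ∈ ({b : Edge n | v ∉ b.1} : Finset _)) then 1 else 0 := by
  rw [isolated, card_filter]
  refine sum_congr rfl fun v _ => ?_
  simp [deg_eq_zero]

lemma sum_isolated (n s : ℕ) (R : Prop) : ∑ f ∈ seqs (Edge n) R s, isolated f =
    n * ∏ i ∈ range s, step R (n.choose 2 - (n - 1)) i := by
  simp_rw [isolated_eq_sum]
  rw [sum_comm]
  simp_rw [← card_filter, card_seqs_filter, card_edges_avoiding]
  simp

lemma sum_isolated_sq_le (n s : ℕ) (R : Prop) : ∑ f ∈ seqs (Edge n) R s, isolated f ^ 2 ≤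
    n * ∏ i ∈ range s, step R (n.choose 2 - (n - 1)) i +
      n ^ 2 * ∏ i ∈ range s, step R (n.choose 2 - (2 * n - 3)) i := by
  have hmono : ∀ {a b : ℕ} (i : ℕ), a ≤ b → step R a i ≤ step R b i := fun i h => by
    unfold step
    split_ifs <;> omega
  have h : ∀ v w : Fin n, ∑ f ∈ seqs (Edge n) R s,
      (if (∀ i, f i ∈ ({b : Edge n | v ∉ b.1} : Finset _)) then 1 else 0) *
        (if (∀ i, f i ∈ ({b : Edge n | w ∉ b.1} : Finset _)) then 1 else 0) ≤
      (if v = w then ∏ i ∈ range s, step R (n.choose 2 - (n - 1)) i else 0) +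
        ∏ i ∈ range s, step R (n.choose 2 - (2 * n - 3)) i := by
    intro v w
    split_ifs with hvw
    · subst hvw
      refine le_trans (le_of_eq ?_) (Nat.le_add_right _ _)
      rw [← card_edges_avoiding v, ← card_seqs_filter, card_filter]
      refine sum_congr rfl fun f _ => ?_
      split_ifs <;> rfl
    · rw [zero_add]
      refine le_trans (le_of_eq ?_)
        (prod_le_prod' fun i _ => hmono i (card_edges_avoiding_two hvw))
      rw [← card_seqs_filter, card_filter]
      refine sum_congr rfl fun f _ => ?_
      simp only [mem_filter, mem_univ, true_and, forall_and]
      split_ifs <;> simp_all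
  calc ∑ f ∈ seqs (Edge n) R s, isolated f ^ 2
      = ∑ v : Fin n, ∑ w : Fin n, ∑ f ∈ seqs (Edge n) R s,
        (if (∀ i, f i ∈ ({b : Edge n | v ∉ b.1} : Finset _)) then 1 else 0) *
          (if (∀ i, f i ∈ ({b : Edge n | w ∉ b.1} : Finset _)) then 1 else 0) := by
        simp_rw [isolated_eq_sum, sq, sum_mul_sum]
        rw [sum_comm]
        refine sum_congr rfl fun v _ => ?_
        rw [sum_comm]
    _ ≤ ∑ v : Fin n, ∑ w : Fin n,
        ((if v = w then ∏ i ∈ range s, step R (n.choose 2 - (n - 1)) i else 0) +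
          ∏ i ∈ range s, step R (n.choose 2 - (2 * n - 3)) i) :=
        sum_le_sum fun v _ => sum_le_sum fun w _ => h v w
    _ = _ := by
        simp [sum_add_distrib]
        ring

/-- Factor by factor, this says that isolation of two distinct vertices is not positively
correlated. For `y` available edges, `(y - (2n - 3)) * y ≤ (y - (n - 1)) ^ 2` reduces to `y ≤ (n -
1) ^ 2` when nothing truncates, and `n.choose 2` satisfies this. -/
lemma step_mul_step_le (hn : 2 ≤ n) (i : ℕ) :
    step R (n.choose 2 - (2 * n - 3)) i * step R (n.choose 2) i ≤
      step R (n.choose 2 - (n - 1)) i ^ 2 := by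
  have key : ∀ y : ℕ, y ≤ (n - 1) ^ 2 → (y - (2 * n - 3)) * y ≤ (y - (n - 1)) ^ 2 := by
    intro y hy
    rcases le_total y (2 * n - 3) with h | h
    · simp [Nat.sub_eq_zero_of_le h]
    · obtain ⟨k, rfl⟩ := Nat.exists_eq_add_of_le' hn
      obtain ⟨z, rfl⟩ := Nat.exists_eq_add_of_le' h
      rw [Nat.add_sub_cancel, show z + (2 * (k + 2) - 3) = z + (2 * k + 1) by omega,
        show z + (2 * k + 1) - (k + 2 - 1) = z + k by omega]
      rw [show z + (2 * (k + 2) - 3) = z + (2 * k + 1) by omega,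
        show k + 2 - 1 = k + 1 by omega] at hy
      nlinarith
  have hN : n.choose 2 ≤ (n - 1) ^ 2 := by
    obtain ⟨k, rfl⟩ := Nat.exists_eq_add_of_le' hn
    have h := Nat.triangle_succ (k + 1)
    rw [Nat.choose_two_right]
    refine Nat.div_le_of_le_mul ?_
    rw [show k + 2 - 1 = k + 1 by omega]
    nlinarith
  unfold step
  split_ifs
  · exact key _ hN
  · rw [Nat.sub_right_comm, Nat.sub_right_comm _ (n - 1)]
    exact key _ ((Nat.sub_le _ _).trans hN)

lemma meanIsolated_eq (R : Prop) (n s : ℕ) : meanIsolated R n s =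
    n * ∏ i ∈ range s, ((step R (n.choose 2 - (n - 1)) i : ℝ) / step R (n.choose 2) i) := by
  have h : ∑ f ∈ seqs (Edge n) R s, (isolated f : ℝ) =
      n * ∏ i ∈ range s, (step R (n.choose 2 - (n - 1)) i : ℝ) := by
    exact_mod_cast sum_isolated n s R
  rw [meanIsolated, h, card_seqs, card_edge, prod_div_distrib]
  push_cast
  ring

/-- The number of isolated vertices has variance at most `n`. -/
lemma sum_sq_sub_meanIsolated_le (hn : 2 ≤ n) (s : ℕ) :
    ∑ f ∈ seqs (Edge n) R s, ((isolated f : ℝ) - meanIsolated R n s) ^ 2 ≤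
      #(seqs (Edge n) R s) * n := by
  rcases Nat.eq_zero_or_pos #(seqs (Edge n) R s) with h0 | hpos
  · rw [card_eq_zero] at h0
    simp [h0]
  set W : ℝ := ((#(seqs (Edge n) R s) : ℕ) : ℝ) with hW
  have hW0 : 0 < W := Nat.cast_pos.2 hpos
  set a₁ : ℝ := ∏ i ∈ range s, (step R (n.choose 2 - (n - 1)) i : ℝ) with ha₁
  set a₂ : ℝ := ∏ i ∈ range s, (step R (n.choose 2 - (2 * n - 3)) i : ℝ) with ha₂
  have hWp : W = ∏ i ∈ range s, (step R (n.choose 2) i : ℝ) := by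
    rw [hW, card_seqs, card_edge]
    push_cast
    rfl
  have h1 : ∑ f ∈ seqs (Edge n) R s, (isolated f : ℝ) = n * a₁ := by
    rw [ha₁]
    exact_mod_cast sum_isolated n s R
  have h2 : ∑ f ∈ seqs (Edge n) R s, (isolated f : ℝ) ^ 2 ≤ n * a₁ + n ^ 2 * a₂ := by
    rw [ha₁, ha₂]
    exact_mod_cast sum_isolated_sq_le n s R
  have h3 : a₂ * W ≤ a₁ ^ 2 := by
    rw [hWp, ha₂, ha₁, ← prod_mul_distrib, ← prod_pow]
    exact prod_le_prod (fun i _ => by positivity) fun i _ => by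
      exact_mod_cast step_mul_step_le hn i
  have h4 : a₁ ≤ W := by
    rw [hWp, ha₁]
    refine prod_le_prod (fun i _ => by positivity) fun i _ => ?_
    have : step R (n.choose 2 - (n - 1)) i ≤ step R (n.choose 2) i := by
      unfold step
      split_ifs <;> omega
    exact_mod_cast this
  have h5 : a₂ ≤ a₁ ^ 2 / W := by rwa [le_div_iff₀ hW0]
  have hm : meanIsolated R n s = n * a₁ / W := by rw [meanIsolated, h1]
  calc ∑ f ∈ seqs (Edge n) R s, ((isolated f : ℝ) - meanIsolated R n s) ^ 2
      = ∑ f ∈ seqs (Edge n) R s, (isolated f : ℝ) ^ 2 - n ^ 2 * (a₁ ^ 2 / W) := by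
        simp_rw [sub_sq]
        rw [sum_add_distrib, sum_sub_distrib, ← sum_mul, ← mul_sum, h1, sum_const,
          nsmul_eq_mul, hm]
        field_simp
        ring
    _ ≤ n * a₁ := by
        have : (n : ℝ) ^ 2 * a₂ ≤ n ^ 2 * (a₁ ^ 2 / W) := by gcongr
        linarith
    _ ≤ W * n := by
        rw [mul_comm]
        gcongr

-- Colorability survives deletion of an edge, so `crit` is a difference of two indicators; every
-- sequence of the other edges has equally many extensions, whichever `j` is.
open scoped Classical in
lemma sum_crit (hW : 0 < #(seqs (Edge n) R (s + 1))) (j : Fin (s + 1)) :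
    ∑ f ∈ seqs (Edge n) R (s + 1), crit q f j =
      #(seqs (Edge n) R (s + 1)) * (prob R q n s - prob R q n (s + 1)) := by
  have hWs : #(seqs (Edge n) R (s + 1)) = #(seqs (Edge n) R s) * step R (n.choose 2) s := by
    rw [card_seqs, card_seqs, prod_range_succ, card_edge]
  have h1 : (0 : ℝ) < #(seqs (Edge n) R s) := by
    have := Nat.pos_of_mul_pos_right (hWs ▸ hW)
    exact_mod_cast this
  have h2 : (0 : ℝ) < #(seqs (Edge n) R (s + 1)) := by exact_mod_cast hW
  have h3 : ∑ f ∈ seqs (Edge n) R (s + 1), (if Col q (j.removeNth f) then (1 : ℝ) else 0) =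
      #{f ∈ seqs (Edge n) R s | Col q f} * step R (n.choose 2) s := by
    rw [sum_seqs_succ j, card_filter]
    push_cast
    rw [sum_mul]
    refine sum_congr rfl fun g hg => ?_
    simp only [Fin.removeNth_insertNth]
    rw [sum_const, card_nexts hg, card_edge, nsmul_eq_mul, mul_comm]
  have h4 : ∀ f : Fin (s + 1) → Edge n, crit q f j =
      (if Col q (j.removeNth f) then (1 : ℝ) else 0) - if Col q f then 1 else 0 := by
    intro f
    by_cases hf : Col q f
    · simp [crit, hf, hf.removeNth j]
    · simp [crit, hf]
  simp_rw [h4]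
  rw [sum_sub_distrib, h3, prob, prob, mul_sub, mul_div_cancel₀ _ h2.ne', hWs, card_filter,
    card_filter]
  push_cast
  field_simp

lemma prob_succ_le (hW : 0 < #(seqs (Edge n) R (s + 1))) :
    prob R q n (s + 1) ≤ prob R q n s := by
  have h := sum_crit (q := q) hW 0
  have h2 : (0 : ℝ) < #(seqs (Edge n) R (s + 1)) := by exact_mod_cast hW
  have h3 : 0 ≤ ∑ f ∈ seqs (Edge n) R (s + 1), crit q f 0 :=
    sum_nonneg fun f _ => by unfold crit; split_ifs <;> simp
  rw [h] at h3
  have := (mul_nonneg_iff_of_pos_left h2).1 h3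
  linarith

/-- Split the mean as `X + (mean - X)`, weighted by the number of critical edges. The first part is
the bias bound; the second is Cauchy–Schwarz with at most `s + 1` critical edges and variance at
most `n`. -/
lemma prob_sub_mul_meanIsolated_le (hq : 2 ≤ q) (hn : 2 ≤ n)
    (hW : 0 < #(seqs (Edge n) R (s + 1))) {κ : ℝ}
    (hκ : κ * step R (n.choose 2) s = (n - 1 : ℕ)) (h0 : 0 < κ) (h1 : κ ≤ 1) :
    (prob R q n s - prob R q n (s + 1)) * meanIsolated R n (s + 1) ≤
      √((s + 1) * (2 * (s + 1) * κ + 2) * (8 * s / n)) / (κ * (s + 1)) + √n := by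
  set W : ℝ := ((#(seqs (Edge n) R (s + 1)) : ℕ) : ℝ) with hWdef
  set m := meanIsolated R n (s + 1) with hm
  set η := √((s + 1) * (2 * (s + 1) * κ + 2) * (8 * s / n)) with hη
  have hW0 : 0 < W := Nat.cast_pos.2 hW
  have hL : 0 < step R (n.choose 2) s := by
    rw [card_seqs, prod_range_succ, card_edge] at hW
    exact Nat.pos_of_mul_pos_left hW
  have ht : (0 : ℝ) < s + 1 := by positivity
  have hc : ∀ f : Fin (s + 1) → Edge n, 0 ≤ ∑ j, crit q f j ∧ ∑ j, crit q f j ≤ s + 1 := by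
    intro f
    have h : ∀ j, 0 ≤ crit q f j ∧ crit q f j ≤ 1 := fun j => by
      unfold crit
      split_ifs <;> simp
    refine ⟨sum_nonneg fun j _ => (h j).1, (sum_le_sum fun j _ => (h j).2).trans ?_⟩
    simp
  have hsum : ∑ f ∈ seqs (Edge n) R (s + 1), ∑ j, crit q f j =
      (s + 1) * (W * (prob R q n s - prob R q n (s + 1))) := by
    rw [sum_comm]
    simp_rw [sum_crit hW]
    simp [hWdef]
  have hA : ∑ f ∈ seqs (Edge n) R (s + 1), (∑ j, crit q f j) * isolated f ≤ W * η / κ := by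
    rw [le_div_iff₀ h0, mul_comm]
    exact sum_sum_crit_mul_isolated_le hκ hq hn hL h0.le h1
  have hB : ∑ f ∈ seqs (Edge n) R (s + 1), (∑ j, crit q f j) * (m - isolated f) ≤
      (s + 1) * (W * √n) := by
    refine (Real.sum_mul_le_sqrt_mul_sqrt _ _ _).trans ?_
    have e1 : ∑ f ∈ seqs (Edge n) R (s + 1), (∑ j, crit q f j) ^ 2 ≤ W * (s + 1) ^ 2 := by
      rw [← nsmul_eq_mul, ← sum_const]
      exact sum_le_sum fun f _ => pow_le_pow_left₀ (hc f).1 (hc f).2 2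
    have e2 : ∑ f ∈ seqs (Edge n) R (s + 1), (m - isolated f) ^ 2 ≤ W * n := by
      refine le_trans (le_of_eq ?_) (sum_sq_sub_meanIsolated_le hn (s + 1))
      exact sum_congr rfl fun f _ => by ring
    refine (mul_le_mul (Real.sqrt_le_sqrt e1) (Real.sqrt_le_sqrt e2) (Real.sqrt_nonneg _)
      (Real.sqrt_nonneg _)).trans (le_of_eq ?_)
    rw [Real.sqrt_mul hW0.le, Real.sqrt_mul hW0.le, Real.sqrt_sq ht.le]
    have := Real.mul_self_sqrt hW0.le
    linear_combination (s + 1) * √n * this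
  have hAB : (s + 1) * (W * (prob R q n s - prob R q n (s + 1))) * m ≤
      W * η / κ + (s + 1) * (W * √n) := by
    rw [← hsum, sum_mul]
    refine le_trans (le_of_eq ?_) (add_le_add hA hB)
    rw [← sum_add_distrib]
    exact sum_congr rfl fun f _ => by ring
  have hfin : W * η / κ + (s + 1) * (W * √n) =
      (s + 1) * W * (η / (κ * (s + 1)) + √n) := by
    field_simp
  rw [hfin] at hAB
  refine le_of_mul_le_mul_left ?_ (mul_pos ht hW0)
  linarith

end Moments

/-! ### Linearly many edges. -/

section SparseRange

variable {n s q K : ℕ} {R : Prop}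

lemma half_choose_two_le_step {i : ℕ} (hn : 4 * K + 1 ≤ n) (hi : i ≤ K * n) :
    (n : ℝ) * (n - 1) / 4 ≤ step R (n.choose 2) i := by
  have h1 : ((n.choose 2 : ℕ) : ℝ) = n * (n - 1) / 2 := Nat.cast_choose_two ℝ n
  have h2 : (i : ℝ) ≤ K * n := by exact_mod_cast hi
  have h3 : (4 : ℝ) * K + 1 ≤ n := by exact_mod_cast hn
  have h4 : (n.choose 2 : ℝ) ≤ step R (n.choose 2) i + i := by
    have : n.choose 2 ≤ step R (n.choose 2) i + i := by
      unfold step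
      split_ifs <;> omega
    exact_mod_cast this
  have h5 : (0 : ℝ) ≤ n := by positivity
  nlinarith

lemma exp_neg_two_mul_le {x : ℝ} (h0 : 0 ≤ x) (h1 : x ≤ 1 / 2) : Real.exp (-(2 * x)) ≤ 1 - x := by
  have h := Real.add_one_le_exp (2 * x)
  rw [Real.exp_neg]
  refine (inv_anti₀ (by linarith) h).trans ?_
  rw [inv_le_iff_one_le_mul₀ (by linarith)]
  nlinarith

/-- At least half of all edges are available at each step, so a vertex stays isolated with
conditional probability at least `1 - 4 / n ≥ exp (-8 / n)`, over at most `K * n` steps. -/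
lemma le_meanIsolated (hn : 4 * K + 1 ≤ n) (hn8 : 8 ≤ n) (hs : s ≤ K * n) :
    n * Real.exp (-(8 * K)) ≤ meanIsolated R n s := by
  rw [meanIsolated_eq]
  refine mul_le_mul_of_nonneg_left ?_ (Nat.cast_nonneg n)
  have hn' : (8 : ℝ) ≤ n := by exact_mod_cast hn8
  have hn0 : (0 : ℝ) < n := by linarith
  have h1 : ∀ i ∈ range s, Real.exp (-(2 * (4 / n))) ≤
      (step R (n.choose 2 - (n - 1)) i : ℝ) / step R (n.choose 2) i := by
    intro i hi
    have hL := half_choose_two_le_step (R := R) hn (((mem_range.1 hi).le).trans hs)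
    have hL0 : (0 : ℝ) < step R (n.choose 2) i := by
      refine lt_of_lt_of_le ?_ hL
      have : (0 : ℝ) < n - 1 := by linarith
      positivity
    refine (exp_neg_two_mul_le (by positivity) ?_).trans ?_
    · rw [div_le_div_iff₀ hn0 two_pos]
      linarith
    · rw [le_div_iff₀ hL0, sub_mul, one_mul]
      have h2 : (step R (n.choose 2) i : ℝ) ≤ step R (n.choose 2 - (n - 1)) i + (n - 1) := by
        have h : step R (n.choose 2) i ≤ step R (n.choose 2 - (n - 1)) i + (n - 1) := by
          unfold step
          split_ifs <;> omega
        have h' : ((n - 1 : ℕ) : ℝ) = n - 1 := by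
          rw [Nat.cast_sub (by omega)]
          simp
        rw [← h']
        exact_mod_cast h
      have h3 : (n : ℝ) - 1 ≤ 4 / n * step R (n.choose 2) i := by
        calc (n : ℝ) - 1 = 4 / n * (n * (n - 1) / 4) := by field_simp
          _ ≤ _ := by gcongr
      linarith
  refine le_trans ?_ (prod_le_prod (fun i _ => (Real.exp_pos _).le) h1)
  rw [prod_const, card_range, ← Real.exp_nat_mul]
  refine Real.exp_le_exp.2 ?_
  have h4 : (s : ℝ) ≤ K * n := by exact_mod_cast hs
  have h5 : (s : ℝ) * (-(2 * (4 / n))) = -(8 * (s / n)) := by ring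
  have h6 : (s : ℝ) / n ≤ K := by rwa [div_le_iff₀ hn0]
  rw [h5]
  linarith

/-- As long as there are linearly many edges, one more edge has little effect. -/
lemma prob_sub_prob_succ_le (hq : 2 ≤ q) (hn : 4 * K + 1 ≤ n) (hn8 : 8 ≤ n)
    (hs : s + 1 ≤ K * n) (hW : 0 < #(seqs (Edge n) R (s + 1))) :
    prob R q n s - prob R q n (s + 1) ≤
      Real.exp (8 * K) * (√(64 * K + 16) / 2 + 1) / √n := by
  have hn' : (8 : ℝ) ≤ n := by exact_mod_cast hn8
  have hn0 : (0 : ℝ) < n := by linarith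
  have ht : (0 : ℝ) < s + 1 := by positivity
  have hsK : (s : ℝ) ≤ K * n := by exact_mod_cast (by omega : s ≤ K * n)
  have hL := half_choose_two_le_step (R := R) hn (by omega : s ≤ K * n)
  have hn1 : (0 : ℝ) < n - 1 := by linarith
  have hL0 : (0 : ℝ) < step R (n.choose 2) s := lt_of_lt_of_le (by positivity) hL
  have hcast : ((n - 1 : ℕ) : ℝ) = n - 1 := by
    rw [Nat.cast_sub (by omega)]
    simp
  -- The chance that the new edge meets a given isolated vertex; it lies between `2 / n` and `4 /
  -- n`.
  set κ : ℝ := (n - 1) / step R (n.choose 2) s with hκdef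
  have hκ : κ * step R (n.choose 2) s = (n - 1 : ℕ) := by
    rw [hcast, hκdef, div_mul_cancel₀ _ hL0.ne']
  have hκ0 : 0 < κ := by positivity
  have hκ4 : κ ≤ 4 / n := by
    rw [hκdef, div_le_div_iff₀ hL0 hn0]
    linarith
  have hκ2 : 2 / n ≤ κ := by
    have h1 : (step R (n.choose 2) s : ℝ) ≤ n * (n - 1) / 2 := by
      rw [← Nat.cast_choose_two ℝ n]
      exact_mod_cast step_le _ _ _
    rw [hκdef, div_le_div_iff₀ hn0 hL0]
    linarith
  have hκ1 : κ ≤ 1 := hκ4.trans (by rw [div_le_one hn0]; linarith)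
  have hmain := prob_sub_mul_meanIsolated_le (q := q) hq (by omega) hW hκ hκ0 hκ1
  have hsqrt : √((s + 1) * (2 * (s + 1) * κ + 2) * (8 * s / n)) ≤
      (s + 1) * (√(64 * K + 16) / √n) := by
    rw [← Real.sqrt_div (by positivity), ← Real.sqrt_sq ht.le, ← Real.sqrt_mul (sq_nonneg _)]
    refine Real.sqrt_le_sqrt ?_
    rw [Real.sqrt_sq ht.le]
    have e1 : (s : ℝ) / n ≤ K := by rwa [div_le_iff₀ hn0]
    have e2 : (2 * ((s : ℝ) + 1) * κ) * (8 * s / n) ≤ (2 * (s + 1) * (4 / n)) * (8 * K) := by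
      have : 8 * (s : ℝ) / n ≤ 8 * K := by
        rw [mul_div_assoc]
        linarith
      gcongr
    have e3 : (2 : ℝ) * (8 * s / n) ≤ (s + 1) * (16 / n) := by
      have : (0 : ℝ) < 16 / n := by positivity
      calc (2 : ℝ) * (8 * s / n) = s * (16 / n) := by ring
        _ ≤ _ := by linarith
    calc ((s : ℝ) + 1) * (2 * (s + 1) * κ + 2) * (8 * s / n)
        = (s + 1) * ((2 * ((s : ℝ) + 1) * κ) * (8 * s / n) + 2 * (8 * s / n)) := by ring
      _ ≤ (s + 1) * ((2 * (s + 1) * (4 / n)) * (8 * K) + (s + 1) * (16 / n)) :=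
        mul_le_mul_of_nonneg_left (add_le_add e2 e3) ht.le
      _ = _ := by ring
  have hdiff : 0 ≤ prob R q n s - prob R q n (s + 1) := sub_nonneg.2 (prob_succ_le hW)
  have hn_sqrt : (0 : ℝ) < √n := Real.sqrt_pos.2 hn0
  have hsq : √(n : ℝ) * √n = n := Real.mul_self_sqrt hn0.le
  have hfirst : √((s + 1) * (2 * (s + 1) * κ + 2) * (8 * s / n)) / (κ * (s + 1)) ≤
      √n * (√(64 * K + 16) / 2) := by
    rw [div_le_iff₀ (by positivity)]
    refine hsqrt.trans ?_
    calc ((s : ℝ) + 1) * (√(64 * K + 16) / √n)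
        = √n * (√(64 * K + 16) / 2) * (2 / n * (s + 1)) := by
          rw [mul_div_assoc', div_eq_iff hn_sqrt.ne']
          have : (n : ℝ)⁻¹ * n = 1 := inv_mul_cancel₀ hn0.ne'
          linear_combination -((s : ℝ) + 1) * √(64 * K + 16) * ((n : ℝ)⁻¹ * hsq + this)
      _ ≤ _ := by gcongr
  have hmean := le_meanIsolated (R := R) hn hn8 hs
  have h1 : (prob R q n s - prob R q n (s + 1)) * (n * Real.exp (-(8 * K))) ≤
      √n * (√(64 * K + 16) / 2 + 1) :=
    (mul_le_mul_of_nonneg_left hmean hdiff).trans (by linarith)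
  rw [le_div_iff₀ hn_sqrt]
  have h2 : Real.exp (8 * K) * Real.exp (-(8 * K)) = 1 := by
    rw [← Real.exp_add]
    simp
  refine le_of_mul_le_mul_left ?_ hn_sqrt
  calc √n * ((prob R q n s - prob R q n (s + 1)) * √n)
      = Real.exp (8 * K) *
        ((prob R q n s - prob R q n (s + 1)) * (n * Real.exp (-(8 * K)))) := by
        linear_combination (prob R q n s - prob R q n (s + 1)) * hsq -
          (prob R q n s - prob R q n (s + 1)) * n * h2
    _ ≤ Real.exp (8 * K) * (√n * (√(64 * K + 16) / 2 + 1)) := by gcongr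
    _ = _ := by ring

end SparseRange

/-! ### Many edges: the first moment bound. -/

section DenseRange

variable {n s q : ℕ} {R : Prop}

/-- By Cauchy–Schwarz the squares of the color class sizes sum to at least `n ^ 2 / q`. This counts
ordered monochromatic pairs including the `n` diagonal ones, which `2 * q ≤ n` makes at most half of
the bound. -/
lemma le_card_monochromatic (c : Fin n → Fin q) (hn : 2 * q ≤ n) :
    n.choose 2 ≤ 2 * q * #{b : Edge n | (b.1.map c).IsDiag} := by
  classical
  set M := #{b : Edge n | (b.1.map c).IsDiag} with hM
  have h1 : ∀ v : Fin n, #{w | c w = c v} ≤ #{b : Edge n | (b.1.map c).IsDiag ∧ v ∈ b.1} + 1 := by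
    intro v
    have hv : v ∈ ({w | c w = c v} : Finset (Fin n)) := by simp
    rw [← card_erase_add_one hv]
    refine Nat.add_le_add_right ?_ 1
    rw [← card_attach]
    refine card_le_card_of_injOn
      (fun w => (⟨s(v, w.1), by simpa using (ne_of_mem_erase w.2).symm⟩ : Edge n)) ?_ ?_
    · rintro ⟨w, hw⟩ -
      have := (mem_filter.1 (mem_of_mem_erase hw)).2
      simp [this]
    · rintro ⟨w, hw⟩ - ⟨w', hw'⟩ - hww
      have : w = w' ∨ v = w' ∧ w = v := by simpa using hww
      grind
  have h2 : ∑ v : Fin n, #{b : Edge n | (b.1.map c).IsDiag ∧ v ∈ b.1} = 2 * M := by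
    simp_rw [card_filter]
    rw [sum_comm, hM, card_filter, mul_sum]
    refine sum_congr rfl fun b _ => ?_
    by_cases hb : (b.1.map c).IsDiag
    · simp only [hb, true_and, if_true, mul_one]
      rw [← card_filter, card_ends]
    · simp [hb]
  have h3 : ∑ v : Fin n, #{w | c w = c v} = ∑ k : Fin q, #{w | c w = k} ^ 2 := by
    rw [← sum_fiberwise_of_maps_to (s := univ) (t := univ) (g := c) (fun _ _ => mem_univ _)]
    refine sum_congr rfl fun k _ => ?_
    rw [sq, ← smul_eq_mul, ← sum_const]
    exact sum_congr rfl fun v hv => by rw [(mem_filter.1 hv).2]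
  have h4 : n ^ 2 ≤ q * ∑ k : Fin q, #{w | c w = k} ^ 2 := by
    have h := sq_sum_le_card_mul_sum_sq (s := (univ : Finset (Fin q)))
      (f := fun k => #{w | c w = k})
    have h' : ∑ k : Fin q, #{w | c w = k} = n := by
      rw [← card_eq_sum_card_fiberwise (fun _ _ => mem_coe.2 (mem_univ _))]
      simp
    rwa [h', card_univ, Fintype.card_fin] at h
  have h5 : ∑ v : Fin n, #{w | c w = c v} ≤ 2 * M + n := by
    rw [← h2]
    refine (sum_le_sum fun v _ => h1 v).trans ?_
    rw [sum_add_distrib]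
    simp
  rw [← h3] at h4
  have h6 : n ^ 2 ≤ q * (2 * M + n) := h4.trans (Nat.mul_le_mul_left q h5)
  have h7 : 2 * n.choose 2 ≤ n ^ 2 := by
    rw [Nat.choose_two_right, sq]
    refine (Nat.mul_div_le _ _).trans (Nat.mul_le_mul_left n (Nat.sub_le _ _))
  nlinarith

lemma card_seqs_filter_le {E : Type*} [Fintype E] [DecidableEq E] (A : Finset E) (s : ℕ) {r : ℝ}
    (hr : (#A : ℝ) ≤ r * Fintype.card E) (hr1 : r ≤ 1) (hr0 : 0 ≤ r) :
    (#{f ∈ seqs E R s | ∀ i, f i ∈ A} : ℝ) ≤ r ^ s * #(seqs E R s) := by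
  rw [card_seqs_filter, card_seqs]
  push_cast
  rw [show r ^ s = ∏ _i ∈ range s, r by simp, ← prod_mul_distrib]
  refine prod_le_prod (fun i _ => by positivity) fun i _ => ?_
  unfold step
  split_ifs
  · exact hr
  -- Without repetition the proportion of allowed items only decreases: `#A - i ≤ r * (card E - i)`
  -- because `r ≤ 1`.
  · rcases le_total i #A with h | h
    · have h' : i ≤ Fintype.card E := h.trans (card_le_univ A)
      rw [Nat.cast_sub h, Nat.cast_sub h']
      have : r * i ≤ 1 * i := by gcongr
      linarith
    · rw [Nat.sub_eq_zero_of_le h]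
      push_cast
      positivity

/-- Graphs with many edges are unlikely to be colorable. -/
lemma prob_le_exp_neg (hq : 1 ≤ q) (hn : 2 * q ≤ n) (hs : 2 * q * (q + 1) * n ≤ s) :
    prob R q n s ≤ Real.exp (-n) := by
  classical
  have hq0 : (0 : ℝ) < q := by exact_mod_cast hq
  have hq1 : (1 : ℝ) ≤ q := by exact_mod_cast hq
  set r : ℝ := 1 - 1 / (2 * q) with hr
  have hr1 : r ≤ 1 := by
    have : (0 : ℝ) ≤ 1 / (2 * q) := by positivity
    linarith
  have hr0 : 0 ≤ r := by
    have : (1 : ℝ) / (2 * q) ≤ 1 := by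
      rw [div_le_one (by positivity)]
      linarith
    linarith
  have hc : ∀ c : Fin n → Fin q, (#{f ∈ seqs (Edge n) R s |
      ∀ i, f i ∈ ({b : Edge n | ¬ (b.1.map c).IsDiag} : Finset _)} : ℝ) ≤
      r ^ s * #(seqs (Edge n) R s) := by
    intro c
    refine card_seqs_filter_le _ s ?_ hr1 hr0
    have h := card_filter_add_card_filter_not (s := (univ : Finset (Edge n)))
      (fun b => (b.1.map c).IsDiag)
    rw [card_univ, card_edge] at h
    have h1 : (#{b : Edge n | (b.1.map c).IsDiag} : ℝ) + #{b : Edge n | ¬ (b.1.map c).IsDiag} =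
        n.choose 2 := by exact_mod_cast h
    have h2 : (n.choose 2 : ℝ) ≤ 2 * q * #{b : Edge n | (b.1.map c).IsDiag} := by
      exact_mod_cast le_card_monochromatic c hn
    have h3 : 1 / (2 * (q : ℝ)) * n.choose 2 ≤ #{b : Edge n | (b.1.map c).IsDiag} := by
      rw [div_mul_eq_mul_div, one_mul, div_le_iff₀ (by positivity)]
      linarith
    rw [card_edge, hr, sub_mul, one_mul]
    linarith
  have hle : (#{f ∈ seqs (Edge n) R s | Col q f} : ℝ) ≤
      q ^ n * r ^ s * #(seqs (Edge n) R s) := by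
    have h1 : #{f ∈ seqs (Edge n) R s | Col q f} ≤ ∑ c : Fin n → Fin q,
        #{f ∈ seqs (Edge n) R s |
          ∀ i, f i ∈ ({b : Edge n | ¬ (b.1.map c).IsDiag} : Finset _)} := by
      refine (card_le_card fun f hf => ?_).trans card_biUnion_le
      rw [mem_filter] at hf
      obtain ⟨hf, c, hc⟩ := hf
      rw [mem_biUnion]
      exact ⟨c, mem_univ _, by simpa [hf] using hc⟩
    have h2 : (#{f ∈ seqs (Edge n) R s | Col q f} : ℝ) ≤ ∑ c : Fin n → Fin q,
        (#{f ∈ seqs (Edge n) R s |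
          ∀ i, f i ∈ ({b : Edge n | ¬ (b.1.map c).IsDiag} : Finset _)} : ℝ) := by
      exact_mod_cast h1
    refine h2.trans ((sum_le_sum fun c _ => hc c).trans (le_of_eq ?_))
    simp [mul_assoc]
  have hexp : (q : ℝ) ^ n * r ^ s ≤ Real.exp (-n) := by
    have h1 : (q : ℝ) ≤ Real.exp q := by
      have := Real.add_one_le_exp (q : ℝ)
      linarith
    have h2 : r ≤ Real.exp (-(1 / (2 * q))) := by
      have := Real.add_one_le_exp (-(1 / (2 * (q : ℝ))))
      linarith
    calc (q : ℝ) ^ n * r ^ s ≤ Real.exp q ^ n * Real.exp (-(1 / (2 * q))) ^ s := by gcongr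
      _ = Real.exp (n * q + s * -(1 / (2 * q))) := by
        rw [← Real.exp_nat_mul, ← Real.exp_nat_mul, ← Real.exp_add]
      _ ≤ Real.exp (-n) := by
        refine Real.exp_le_exp.2 ?_
        have h3 : 2 * (q : ℝ) * (q + 1) * n ≤ s := by exact_mod_cast hs
        have h4 : ((q : ℝ) + 1) * n ≤ s * (1 / (2 * q)) := by
          rw [mul_one_div, le_div_iff₀ (by positivity)]
          linarith
        linarith
  rw [prob]
  exact (div_le_of_le_mul₀ (by positivity) (by positivity) hle).trans hexp

end DenseRange

/-- One more edge lowers the probability of colorability by at most the order of `1 / √n`. -/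
theorem exists_prob_sub_prob_succ_le {q : ℕ} (hq : 2 ≤ q) :
    ∃ C : ℝ, 0 < C ∧ ∃ N : ℕ, ∀ n, N ≤ n → ∀ (R : Prop) (s : ℕ),
      0 < #(seqs (Edge n) R (s + 1)) → prob R q n s - prob R q n (s + 1) ≤ C / √n := by
  -- From `K * n` edges on, `(1 - 1 / (2q)) ^ s ≤ exp (-(q + 1) * n)`, which beats the `q ^ n ≤ exp
  -- (q * n)` colorings by a factor `exp (-n)`.
  set K : ℕ := 2 * q * (q + 1) with hK
  have hC : 1 ≤ Real.exp (8 * K) * (√(64 * K + 16) / 2 + 1) := by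
    have h1 : 1 ≤ Real.exp (8 * K) := Real.one_le_exp (by positivity)
    have h2 : (1 : ℝ) ≤ √(64 * K + 16) / 2 + 1 := by
      have := Real.sqrt_nonneg (64 * (K : ℝ) + 16)
      linarith
    exact one_le_mul_of_one_le_of_one_le h1 h2
  refine ⟨Real.exp (8 * K) * (√(64 * K + 16) / 2 + 1), lt_of_lt_of_le one_pos hC,
    4 * K + 8 + 2 * q, fun n hn R s hW => ?_⟩
  rcases lt_or_ge s (K * n) with hs | hs
  · exact prob_sub_prob_succ_le hq (by omega) (by omega) hs hW
  · have h1 : prob R q n s ≤ Real.exp (-n) := prob_le_exp_neg (by omega) (by omega) hs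
    have h2 : 0 ≤ prob R q n (s + 1) := by
      unfold prob
      positivity
    have hn1 : (1 : ℝ) ≤ n := by exact_mod_cast (by omega : 1 ≤ n)
    have h3 : Real.exp (-n) ≤ 1 / √n := by
      rw [Real.exp_neg, ← one_div]
      refine one_div_le_one_div_of_le (Real.sqrt_pos.2 (by linarith)) ?_
      refine (Real.sqrt_le_self_iff.2 (Or.inr hn1)).trans ?_
      have := Real.add_one_le_exp (n : ℝ)
      linarith
    have h4 : 1 / √(n : ℝ) ≤ Real.exp (8 * K) * (√(64 * K + 16) / 2 + 1) / √n := by gcongr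
    linarith

/-! ### The two models as sequences, and summation over the steps. -/

section Models

variable {n m q : ℕ} {R : Prop}

lemma card_seqs_pos (h : R ∨ m ≤ n.choose 2) (hn : 2 ≤ n) : 0 < #(seqs (Edge n) R m) := by
  rw [card_seqs, card_edge]
  refine prod_pos fun i hi => ?_
  have h1 := mem_range.1 hi
  have h2 : 0 < n.choose 2 := Nat.choose_pos hn
  unfold step
  split_ifs with hR
  · exact h2
  · have := h.resolve_left hR
    omega

lemma probWithReplacement_eq (q n m : ℕ) : probWithReplacement q n m = prob True q n m := by
  classical
  have h : seqs (Edge n) True m = univ := by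
    ext f
    simp [mem_seqs]
  rw [probWithReplacement, prob, h, Nat.card_eq_fintype_card, Nat.card_eq_fintype_card,
    Fintype.card_subtype, card_univ]
  simp only [colorable_range_iff]

/-- Every set of `m` items arises from `m!` sequences without repetitions. -/
lemma card_seqs_filter_image {E : Type*} [Fintype E] [DecidableEq E] (p : Finset E → Prop)
    [DecidablePred p] :
    #{f ∈ seqs E False m | p (univ.image f)} =
      #{S : Finset E | #S = m ∧ p S} * m.factorial := by
  have hmaps : ∀ f ∈ ({f ∈ seqs E False m | p (univ.image f)} : Finset (Fin m → E)),
      univ.image f ∈ ({S : Finset E | #S = m ∧ p S} : Finset _) := by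
    intro f hf
    rw [mem_filter, mem_seqs, false_or] at hf
    rw [mem_filter, card_image_of_injective _ hf.1]
    simpa using hf.2
  rw [card_eq_sum_card_fiberwise hmaps, ← smul_eq_mul, ← sum_const]
  refine sum_congr rfl fun S hS => ?_
  obtain ⟨-, hcard, hp⟩ := mem_filter.1 hS
  -- As `#S = m`, injective sequences with items in `S` are exactly those with image `S`, and there
  -- are `m!` of them.
  have h := card_seqs_filter (R := False) S m
  simp only [step, if_false] at h
  rw [← Nat.descFactorial_eq_prod_range, hcard, Nat.descFactorial_self] at h
  rw [← h]
  congr 1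
  ext f
  simp only [mem_filter]
  constructor
  · rintro ⟨⟨hf, -⟩, rfl⟩
    exact ⟨hf, fun i => mem_image_of_mem f (mem_univ i)⟩
  · rintro ⟨hf, hfS⟩
    have hinj : Function.Injective f := by simpa [mem_seqs] using hf
    have himage : univ.image f = S := by
      refine eq_of_subset_of_card_le (fun b hb => ?_) ?_
      · obtain ⟨i, -, rfl⟩ := mem_image.1 hb
        exact hfS i
      · rw [card_image_of_injective _ hinj, hcard]
        simp
    exact ⟨⟨hf, himage ▸ hp⟩, himage⟩

lemma probWithoutReplacement_eq (q n m : ℕ) :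
    probWithoutReplacement q n m = prob False q n m := by
  classical
  have h1 := card_seqs_filter_image (E := Edge n) (m := m)
    (fun S => (graphOf (S : Set (Edge n))).Colorable q)
  have h2 := card_seqs_filter_image (E := Edge n) (m := m) (fun _ => True)
  simp only [coe_image, coe_univ, Set.image_univ, colorable_range_iff] at h1
  simp only [and_true, filter_true] at h2
  rw [probWithoutReplacement, prob, h1, h2, Nat.card_eq_fintype_card, Nat.card_eq_fintype_card,
    Fintype.card_subtype, Fintype.card_subtype]
  push_cast
  rw [mul_div_mul_right _ _ (by positivity)]

lemma prob_sub_prob_le {a : ℝ} {m₁ m₂ : ℕ} (hm : m₁ ≤ m₂)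
    (h : ∀ s, s + 1 ≤ m₂ → prob R q n s - prob R q n (s + 1) ≤ a) :
    prob R q n m₁ - prob R q n m₂ ≤ (m₂ - m₁) * a := by
  induction m₂, hm using Nat.le_induction with
  | base => simp
  | succ k hk ih =>
    have h1 := ih fun s hs => h s (by omega)
    have h2 := h k le_rfl
    push_cast
    linarith

lemma prob_antitone {m₁ m₂ : ℕ} (hm : m₁ ≤ m₂) (hn : 2 ≤ n) (h : R ∨ m₂ ≤ n.choose 2) :
    prob R q n m₂ ≤ prob R q n m₁ := by
  induction m₂, hm using Nat.le_induction with
  | base => rfl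
  | succ k hk ih =>
    exact (prob_succ_le (card_seqs_pos h hn)).trans (ih (h.imp_right fun h => by omega))

lemma transitionWidthAtLeast_prob {C p₁ p₂ : ℝ} (hC : 0 < C) (hn : 2 ≤ n) (hp : p₂ < p₁)
    (h : ∀ s, 0 < #(seqs (Edge n) R (s + 1)) → prob R q n s - prob R q n (s + 1) ≤ C / √n) :
    TransitionWidthAtLeast {m | R ∨ m ≤ n.choose 2} (prob R q n) p₁ p₂
      (1 / C * (p₁ - p₂) * √n) := by
  intro m₁ hm₁ m₂ hm₂ h₁ h₂
  -- If `m₂ ≤ m₁`, monotonicity would give `p₁ ≤ p₂`; otherwise sum the one-step drops.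
  rcases le_total m₂ m₁ with hm | hm
  · have := prob_antitone (q := q) hm hn hm₁
    linarith
  · have h3 := prob_sub_prob_le (a := C / √n) hm fun s hs =>
      h s (card_seqs_pos (hm₂.imp_right fun h => hs.trans h) hn)
    have hn0 : (0 : ℝ) < √n := Real.sqrt_pos.2 (by exact_mod_cast (by omega : 0 < n))
    have h4 : p₁ - p₂ ≤ (m₂ - m₁) * (C / √n) := by linarith
    calc 1 / C * (p₁ - p₂) * √n ≤ 1 / C * ((m₂ - m₁) * (C / √n)) * √n := by gcongr
      _ = m₂ - m₁ := by field_simp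

end Models

end RandomColoring

theorem mainTheorem4 (q : ℕ) (hq : 3 ≤ q) :
    ∃ c : ℝ, 0 < c ∧ ∀ p₁ p₂ : ℝ, 0 < p₂ → p₂ < p₁ → p₁ < 1 →
      ∃ N : ℕ, ∀ n : ℕ, N ≤ n →
        RandomColoring.TransitionWidthAtLeast {m : ℕ | m ≤ n.choose 2}
          (RandomColoring.probWithoutReplacement q n) p₁ p₂ (c * (p₁ - p₂) * Real.sqrt n) ∧
        RandomColoring.TransitionWidthAtLeast Set.univ
          (RandomColoring.probWithReplacement q n) p₁ p₂ (c * (p₁ - p₂) * Real.sqrt n) := by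
  obtain ⟨C, hC, N, h⟩ := RandomColoring.exists_prob_sub_prob_succ_le (q := q) (by omega)
  refine ⟨1 / C, by positivity, fun p₁ p₂ _ hp _ => ⟨max N 2, fun n hn => ?_⟩⟩
  have hN : N ≤ n := (le_max_left _ _).trans hn
  have h2 : 2 ≤ n := (le_max_right _ _).trans hn
  constructor
  · have h1 := RandomColoring.transitionWidthAtLeast_prob hC h2 hp (h n hN False)
    simp only [false_or] at h1
    rwa [funext (RandomColoring.probWithoutReplacement_eq q n)]
  · have h1 := RandomColoring.transitionWidthAtLeast_prob hC h2 hp (h n hN True)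
    simp only [true_or, Set.ofPred_true] at h1
    rwa [funext (RandomColoring.probWithReplacement_eq q n)]
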